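/- Let $n\ge 0$, let $S_n$ be the symmetric group on $[n]=\{1,\dots,n\}$ with product $(\pi\tau)(i)=\pi(\tau(i))$, and for $\pi\in S_n$ let $\mathrm{Des}(\pi)=\{i\in[n-1] : \pi(i)>\pi(i+1)\}$. For $J\subseteq[n-1]$ put $$R_J^{-1}=\{\pi^{-1} : \pi\in S_n,\ \mathrm{Des}(\pi)\subseteq J\},\qquad D_J^{-1}=\{\pi^{-1} : \pi\in S_n,\ \mathrm{Des}(\pi)=J\}.$$ For finite multisets $A,B$ of elements of $S_n$, let $AB$ be the multiset of all products $\pi\tau$ with $\pi\in A$, $\tau\in B$ (counted with multiplicity), and write $A\equiv B$ if $\sum_{\pi\in A}\mathbf{x}^{\mathrm{Des}(\pi)}=\sum_{\pi\in B}\mathbf{x}^{\mathrm{Des}(\pi)}$, i.e. if every subset of $[n-1]$ occurs equally often as a descent set in $A$ and in $B$. Call $B$ *$D$-commutative with all inverse $J$-classes* if $BR_J^{-1}\equiv R_J^{-1}B$ for all $J\subseteq[n-1]$. For a composition $\alpha=(\alpha_1,\dots,\alpha_p)$ of $n$ let $M_\alpha=\sum_{i_1<\cdots<i_p}x_{i_1}^{\alpha_1}\cdots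 x_{i_p}^{\alpha_p}$ and $F_\alpha=\sum_{\beta}M_\beta$, the sum being over all refinements $\beta$ of $\alpha$. For $J=\{j_1<\cdots<j_s\}\subseteq[n-1]$ let $F_{J,n}=F_\alpha$ with $\alpha=(j_1,j_2-j_1,\dots,n-j_s)$ (the empty composition if $n=0$), and let $Q(B)=\sum_{\pi\in B}F_{\mathrm{Des}(\pi),n}$. Call $B$ *fine* if $Q(B)$ is Schur positive, i.e. $Q(B)=\sum_{\lambda\vdash n}c_\lambda s_\lambda$ with nonnegative integers $c_\lambda$, where $s_\lambda$ is the Schur function, the generating function of the semistandard Young tableaux of shape $\lambda$. **Corollary.** If a finite multiset $B$ of elements of $S_n$ is fine, then $B$ is $D$-commutative with all inverse $J$-classes. Moreover (the conjecture of Elizalde and Roichman), $BD_J^{-1}\equiv D_J^{-1}B$ for every $J\subseteq[n-1]$. -/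

import Mathlib

/-! Permutations of `[n]` are `Equiv.Perm (Fin n)`, with `(π * τ) i = π (τ i)`.  A subset of `[n-1]`
is a `Finset (Fin (n - 1))`, in which `i : Fin (n - 1)` stands for the number `i + 1 ∈ [n-1]`.
Formal power series in countably many commuting variables are `MvPowerSeries ℕ ℚ`. -/

namespace DCommutative

/-- The descent set of a permutation: the position `i` (that is, `i + 1` in one-based numbering)
is a descent if the entry at position `i` exceeds the entry at the following position. -/
def Des {n : ℕ} (π : Equiv.Perm (Fin n)) : Finset (Fin (n - 1)) :=
  Finset.univ.filter fun i =>
    π ⟨(i : ℕ) + 1, by have := i.isLt; omega⟩ < π ⟨(i : ℕ), by have := i.isLt; omega⟩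

/-- The inverse `J`-class `R_J⁻¹ = {π⁻¹ : Des π ⊆ J}`. -/
def invR {n : ℕ} (J : Finset (Fin (n - 1))) : Finset (Equiv.Perm (Fin n)) :=
  (Finset.univ.filter fun π => Des π ⊆ J).image fun π => π⁻¹

/-- The inverse descent class `D_J⁻¹ = {π⁻¹ : Des π = J}`. -/
def invD {n : ℕ} (J : Finset (Fin (n - 1))) : Finset (Equiv.Perm (Fin n)) :=
  (Finset.univ.filter fun π => Des π = J).image fun π => π⁻¹

/-- The multiset `AB` of all products `π τ` with `π ∈ A` and `τ ∈ B`, with multiplicities. -/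
def mulMultiset {n : ℕ} (A B : Multiset (Equiv.Perm (Fin n))) : Multiset (Equiv.Perm (Fin n)) :=
  (A ×ˢ B).map fun p => p.1 * p.2

/-- `A ≡ B`: every descent set occurs equally often in `A` and in `B`, that is,
the generating functions of the descent sets of `A` and of `B` coincide. -/
def DesEquiv {n : ℕ} (A B : Multiset (Equiv.Perm (Fin n))) : Prop :=
  A.map Des = B.map Des

/-- `B` is `D`-commutative with all inverse `J`-classes. -/
def IsDCommutative {n : ℕ} (B : Multiset (Equiv.Perm (Fin n))) : Prop :=
  ∀ J : Finset (Fin (n - 1)),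
    DesEquiv (mulMultiset B (invR J).val) (mulMultiset (invR J).val B)

/-- The composition `co(J) = (j₁, j₂ - j₁, …, n - j_s)` of `n` attached to
`J = {j₁ < ⋯ < j_s} ⊆ [n-1]`: its partial sums are `0`, the elements of `J`, and `n`. -/
def co {n : ℕ} (J : Finset (Fin (n - 1))) : Composition n :=
  ((compositionAsSetEquiv n).symm J).toComposition

/-- The composition `β` is a refinement of `α`: each partial sum of `α` is one of `β`. -/
def Refines {n : ℕ} (β α : Composition n) : Prop :=
  α.boundaries ⊆ β.boundaries

/-- The monomial quasisymmetric function `M_α`, the sum of the monomials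
`x_{i₁}^{α₁} ⋯ x_{i_p}^{α_p}` over all `i₁ < ⋯ < i_p`: the coefficient at the exponent vector `d`
is the number of index sequences that give the monomial with exponent vector `d`. -/
noncomputable def monomialQSym {n : ℕ} (α : Composition n) : MvPowerSeries ℕ ℚ := fun d =>
  (Nat.card {i : Fin α.length → ℕ //
    StrictMono i ∧ ∑ k, Finsupp.single (i k) (α.blocksFun k) = d} : ℚ)

open Classical in
/-- Gessel's fundamental quasisymmetric function `F_α`, the sum of `M_β` over all refinements `β`
of `α`. -/
noncomputable def fundamentalQSym {n : ℕ} (α : Composition n) : MvPowerSeries ℕ ℚ :=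
  ∑ β ∈ Finset.univ.filter (fun β : Composition n => Refines β α), monomialQSym β

/-- `Q(B)`, the sum of `F_{Des π, n}` over `π ∈ B`, with multiplicities. -/
noncomputable def Q {n : ℕ} (B : Multiset (Equiv.Perm (Fin n))) : MvPowerSeries ℕ ℚ :=
  (B.map fun π => fundamentalQSym (co (Des π))).sum

/-- The Schur function `s_μ`, the generating function of the semistandard Young tableaux of shape
`μ`: the coefficient at `d` is the number of those in which each `k` occurs exactly `d k` times. -/
noncomputable def schur (μ : YoungDiagram) : MvPowerSeries ℕ ℚ := fun d =>
  (Nat.card {T : SemistandardYoungTableau μ //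
    ∀ k : ℕ, (μ.cells.filter fun c => T c.1 c.2 = k).card = d k} : ℚ)

/-- `f` is a linear combination of Schur functions `s_μ`, with `μ` a partition of `n`,
with coefficients that are nonnegative integers. -/
def SchurPositive (n : ℕ) (f : MvPowerSeries ℕ ℚ) : Prop :=
  ∃ c : YoungDiagram →₀ ℕ, (∀ μ ∈ c.support, μ.card = n) ∧ f = c.sum fun μ m => m • schur μ

/-- A multiset of permutations is fine if its quasisymmetric function is Schur positive. -/
def IsFine {n : ℕ} (B : Multiset (Equiv.Perm (Fin n))) : Prop :=
  SchurPositive n (Q B)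

end DCommutative

/-! Schur positivity enters only through symmetry: Schur functions are symmetric (Bender–Knuth),
hence so is `Q B`. The coefficient of `Q B` at the content of a weakly increasing word `w` counts
the `π ∈ B` with `Des π ⊆ ascents w`, so this count does not change when the letters are renamed by
a finitary permutation of `ℕ` and the word is sorted again (`IsFine.countP_eq`).

Fix `J`, `K`, `π`. An element of `R_J⁻¹` is determined by its word of `J`-blocks, so `σ ↦ κ`, the
element of `R_J⁻¹` with the block word of `σπ`, is a bijection of `R_J⁻¹`. Under it, `Des (σπ) ⊆ K`
becomes `Des κ ⊆ K` together with `Des π ⊆ ascents (pairWord J K κ)`. For `R_J⁻¹B` the number of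
products with descent set inside `K` is thus a sum of coefficients of `Q B` over `κ ∈ R_J⁻¹ ∩ R_K`.
Inverting products turns the count for `BR_J⁻¹` into the same sum with `J` and `K` exchanged.

The content of `pairWord J K κ` is a matrix counting positions by `K`-block and `J`-block; passing
to `κ⁻¹` transposes it. Transposition only permutes variables, so the two sums agree by symmetry.
Inclusion–exclusion over `K` gives equality of descent distributions, and over `J` replaces `R_J⁻¹`
by `D_J⁻¹`. -/

namespace DCommutative

open Finset

/-! ### The Bender–Knuth involution, through row counts. -/

section BenderKnuth

variable {μ : YoungDiagram}

theorem exists_not_cell_lt (T : SemistandardYoungTableau μ) (k i : ℕ) :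
    ∃ j, ¬ ((i, j) ∈ μ ∧ T i j < k) :=
  ⟨μ.rowLen i, fun h => lt_irrefl _ (YoungDiagram.mem_iff_lt_rowLen.1 h.1)⟩

open Classical in
/-- The number of entries less than `k` in the `i`-th row of the tableau `T`. -/
noncomputable def rowCount (T : SemistandardYoungTableau μ) (k i : ℕ) : ℕ :=
  Nat.find (exists_not_cell_lt T k i)

theorem lt_rowCount {T : SemistandardYoungTableau μ} {k i j : ℕ} :
    j < rowCount T k i ↔ (i, j) ∈ μ ∧ T i j < k := by
  classical
  unfold rowCount
  rw [Nat.lt_find_iff]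
  constructor
  · intro h
    exact not_not.1 (h j le_rfl)
  · rintro ⟨h1, h2⟩ m hm
    rw [not_not]
    exact ⟨μ.up_left_mem le_rfl hm h1, (T.row_weak_of_le hm h1).trans_lt h2⟩

theorem rowCount_mono (T : SemistandardYoungTableau μ) (i : ℕ) {k l : ℕ} (h : k ≤ l) :
    rowCount T k i ≤ rowCount T l i :=
  le_of_forall_lt fun j hj => by
    rw [lt_rowCount] at hj ⊢
    exact ⟨hj.1, hj.2.trans_le h⟩

/-- Column strictness, in the form of Gelfand–Tsetlin interlacing. -/
theorem rowCount_succ_succ_le (T : SemistandardYoungTableau μ) (k i : ℕ) :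
    rowCount T (k + 1) (i + 1) ≤ rowCount T k i :=
  le_of_forall_lt fun j hj => by
    rw [lt_rowCount] at hj ⊢
    exact ⟨μ.up_left_mem (Nat.le_succ i) le_rfl hj.1,
      by have := T.col_strict (Nat.lt_add_one i) hj.1; omega⟩

theorem rowCount_eq_zero (T : SemistandardYoungTableau μ) (k : ℕ) {i : ℕ} (h : μ.colLen 0 ≤ i) :
    rowCount T k i = 0 := by
  by_contra h0
  have h1 := (lt_rowCount.1 (Nat.pos_of_ne_zero h0)).1
  rw [YoungDiagram.mem_iff_lt_colLen] at h1
  omega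

/-- The number of occurrences of `k` in the tableau `T`. -/
def content (T : SemistandardYoungTableau μ) (k : ℕ) : ℕ :=
  (μ.cells.filter fun c => T c.1 c.2 = k).card

theorem content_add_sum_rowCount (T : SemistandardYoungTableau μ) (k : ℕ) :
    content T k + ∑ i ∈ range (μ.colLen 0), rowCount T k i =
      ∑ i ∈ range (μ.colLen 0), rowCount T (k + 1) i := by
  have h : content T k = ∑ i ∈ range (μ.colLen 0), (rowCount T (k + 1) i - rowCount T k i) := by
    unfold content
    rw [card_eq_sum_card_fiberwise (f := Prod.fst) (t := range (μ.colLen 0))]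
    · refine sum_congr rfl fun i _ => ?_
      rw [← Nat.card_Ico]
      refine card_bij (fun c _ => c.2) ?_ ?_ ?_
      · rintro ⟨a, b⟩ hc
        simp only [mem_filter, YoungDiagram.mem_cells] at hc
        obtain ⟨⟨h1, h2⟩, rfl⟩ := hc
        change b ∈ _
        change T a b = k at h2
        rw [mem_Ico, ← not_lt, lt_rowCount, lt_rowCount]
        exact ⟨fun h => by omega, h1, by omega⟩
      · rintro ⟨a, b⟩ hc ⟨a', b'⟩ hc' h
        simp only [mem_filter] at hc hc' h
        rw [Prod.mk.injEq]
        exact ⟨hc.2.trans hc'.2.symm, h⟩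
      · intro b hb
        rw [mem_Ico, ← not_lt, lt_rowCount, lt_rowCount] at hb
        refine ⟨(i, b), ?_, rfl⟩
        simp only [mem_filter, YoungDiagram.mem_cells, and_true]
        refine ⟨hb.2.1, ?_⟩
        have h1 := hb.2.2
        have h2 : ¬ T i b < k := fun h => hb.1 ⟨hb.2.1, h⟩
        omega
    · rintro ⟨a, b⟩ hc
      simp only [coe_filter, Set.mem_ofPred_eq, YoungDiagram.mem_cells] at hc
      have h1 := YoungDiagram.mem_iff_lt_colLen.1 (μ.up_left_mem le_rfl (Nat.zero_le b) hc.1)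
      simpa using h1
  rw [h, ← sum_add_distrib]
  exact sum_congr rfl fun i _ => Nat.sub_add_cancel (rowCount_mono T i (Nat.le_succ k))

/-- The least possible number of entries at most `k` in row `i`, given all the entries other than
`k` and `k + 1`. -/
noncomputable def loCount (T : SemistandardYoungTableau μ) (k i : ℕ) : ℕ :=
  max (rowCount T k i) (rowCount T (k + 2) (i + 1))

/-- The greatest possible number of entries at most `k` in row `i`, given all the entries other
than `k` and `k + 1`. -/
noncomputable def hiCount (T : SemistandardYoungTableau μ) (k : ℕ) : ℕ → ℕ
  | 0 => rowCount T (k + 2) 0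
  | i + 1 => min (rowCount T (k + 2) (i + 1)) (rowCount T k i)

theorem loCount_le (T : SemistandardYoungTableau μ) (k i : ℕ) :
    loCount T k i ≤ rowCount T (k + 1) i :=
  max_le (rowCount_mono T i (Nat.le_succ k)) (rowCount_succ_succ_le T (k + 1) i)

theorem le_hiCount (T : SemistandardYoungTableau μ) (k i : ℕ) :
    rowCount T (k + 1) i ≤ hiCount T k i := by
  cases i with
  | zero => exact rowCount_mono T 0 (Nat.le_succ _)
  | succ i => exact le_min (rowCount_mono T _ (Nat.le_succ _)) (rowCount_succ_succ_le T k i)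

theorem hiCount_le (T : SemistandardYoungTableau μ) (k i : ℕ) :
    hiCount T k i ≤ rowCount T (k + 2) i := by
  cases i with
  | zero => exact le_rfl
  | succ i => exact min_le_left _ _

/-- The number of entries at most `k` in row `i` after the Bender–Knuth involution. -/
noncomputable def midCount (T : SemistandardYoungTableau μ) (k i : ℕ) : ℕ :=
  loCount T k i + hiCount T k i - rowCount T (k + 1) i

theorem loCount_le_midCount (T : SemistandardYoungTableau μ) (k i : ℕ) :
    loCount T k i ≤ midCount T k i := by
  have := le_hiCount T k i
  unfold midCount; omega

theorem midCount_le_hiCount (T : SemistandardYoungTableau μ) (k i : ℕ) :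
    midCount T k i ≤ hiCount T k i := by
  have := loCount_le T k i
  unfold midCount; omega

/-- The maximum in `loCount` for row `i` and the minimum in `hiCount` for row `i + 1` involve the
same two numbers, so they add up to the sum of those numbers; the boundary terms vanish below the
last row. This is why reflecting every row count exchanges the two contents. -/
theorem sum_loCount_add_hiCount (T : SemistandardYoungTableau μ) (k : ℕ) :
    ∑ i ∈ range (μ.colLen 0), (loCount T k i + hiCount T k i) =
      ∑ i ∈ range (μ.colLen 0), (rowCount T k i + rowCount T (k + 2) i) := by
  have key : ∀ N, ∑ i ∈ range N, (loCount T k i + hiCount T k i) + hiCount T k N =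
      ∑ i ∈ range N, (rowCount T k i + rowCount T (k + 2) i) + rowCount T (k + 2) N := by
    intro N
    induction N with
    | zero => simp [hiCount]
    | succ N ih =>
      rw [sum_range_succ, sum_range_succ]
      have : loCount T k N + hiCount T k (N + 1) =
          rowCount T k N + rowCount T (k + 2) (N + 1) := by
        simp only [loCount, hiCount]
        omega
      omega
  have h := key (μ.colLen 0)
  have h1 := rowCount_eq_zero T (k + 2) (le_refl (μ.colLen 0))
  have h2 := hiCount_le T k (μ.colLen 0)
  omega

open Classical in
/-- The entries of the image of `T` under the Bender–Knuth involution. -/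
noncomputable def bkEntry (T : SemistandardYoungTableau μ) (k i j : ℕ) : ℕ :=
  if (i, j) ∈ μ ∧ (T i j = k ∨ T i j = k + 1) then
    if j < midCount T k i then k else k + 1
  else T i j

theorem lt_midCount_of_lt {T : SemistandardYoungTableau μ} {k i j : ℕ} (h : (i, j) ∈ μ)
    (hT : T i j < k) : j < midCount T k i :=
  (lt_rowCount.2 ⟨h, hT⟩).trans_le ((le_max_left _ _).trans (loCount_le_midCount T k i))

theorem mem_of_lt_midCount {T : SemistandardYoungTableau μ} {k i j : ℕ}
    (h : j < midCount T k i) : (i, j) ∈ μ ∧ T i j < k + 2 :=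
  lt_rowCount.1 (h.trans_le ((midCount_le_hiCount T k i).trans (hiCount_le T k i)))

/-- The image of `T` under the Bender–Knuth involution that exchanges the numbers of occurrences of
`k` and of `k + 1`. -/
noncomputable def bk (k : ℕ) (T : SemistandardYoungTableau μ) : SemistandardYoungTableau μ where
  entry := bkEntry T k
  row_weak' {i j1 j2} hj h2 := by
    have h1 : (i, j1) ∈ μ := μ.up_left_mem le_rfl hj.le h2
    have hT := T.row_weak hj h2
    simp only [bkEntry, h1, h2, true_and]
    split_ifs <;> omega
  col_strict' {i1 i2 j} hi h2 := by
    have h1 : (i1, j) ∈ μ := μ.up_left_mem hi.le le_rfl h2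
    have hT := T.col_strict hi h2
    simp only [bkEntry, h1, h2, true_and]
    -- Strictness is at risk only for a `k` above a `k + 1`, necessarily in adjacent rows; there
    -- `loCount` and `hiCount` force both entries to stay.
    by_cases hc : T i1 j = k ∧ T i2 j = k + 1
    · have hi2 : i2 = i1 + 1 := by
        by_contra hne
        have hlt : i1 + 1 < i2 := by omega
        have hm : (i1 + 1, j) ∈ μ := μ.up_left_mem hlt.le le_rfl h2
        have := T.col_strict (Nat.lt_add_one i1) hm
        have := T.col_strict hlt h2
        omega
      subst hi2
      have ha : j < midCount T k i1 :=
        (lt_rowCount.2 ⟨h2, by omega⟩ : j < rowCount T (k + 2) (i1 + 1)).trans_le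
          ((le_max_right _ _).trans (loCount_le_midCount T k i1))
      have hb : ¬ j < midCount T k (i1 + 1) := fun h => by
        have h' := lt_rowCount.1
          (h.trans_le ((midCount_le_hiCount T k (i1 + 1)).trans (min_le_right _ _)))
        omega
      simp [hc.1, hc.2, ha, hb]
    · split_ifs <;> omega
  zeros' {i j} h := by
    simp only [bkEntry, h, false_and, if_false]
    exact T.zeros h

theorem bk_apply (k : ℕ) (T : SemistandardYoungTableau μ) (i j : ℕ) :
    bk k T i j = bkEntry T k i j := rfl

theorem rowCount_bk_of_le {k m : ℕ} (T : SemistandardYoungTableau μ) (i : ℕ)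
    (hm : m ≤ k ∨ k + 2 ≤ m) : rowCount (bk k T) m i = rowCount T m i := by
  refine eq_of_forall_lt_iff fun j => ?_
  rw [lt_rowCount, lt_rowCount, bk_apply]
  refine and_congr_right fun h => ?_
  simp only [bkEntry, h, true_and]
  split_ifs <;> omega

theorem rowCount_bk_succ (k : ℕ) (T : SemistandardYoungTableau μ) (i : ℕ) :
    rowCount (bk k T) (k + 1) i = midCount T k i := by
  refine eq_of_forall_lt_iff fun j => ?_
  rw [lt_rowCount, bk_apply]
  constructor
  · rintro ⟨h, hlt⟩
    simp only [bkEntry, h, true_and] at hlt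
    split_ifs at hlt with h1 h2
    · exact h2
    · omega
    · exact lt_midCount_of_lt h (by omega)
  · intro h
    obtain ⟨h1, h2⟩ := mem_of_lt_midCount h
    refine ⟨h1, ?_⟩
    simp only [bkEntry, h1, h, true_and, if_true]
    split_ifs <;> omega

theorem loCount_bk (k : ℕ) (T : SemistandardYoungTableau μ) (i : ℕ) :
    loCount (bk k T) k i = loCount T k i := by
  unfold loCount
  rw [rowCount_bk_of_le T i (Or.inl le_rfl), rowCount_bk_of_le T _ (Or.inr le_rfl)]

theorem hiCount_bk (k : ℕ) (T : SemistandardYoungTableau μ) (i : ℕ) :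
    hiCount (bk k T) k i = hiCount T k i := by
  cases i <;> simp only [hiCount] <;>
    simp only [rowCount_bk_of_le T _ (Or.inl le_rfl), rowCount_bk_of_le T _ (Or.inr le_rfl)]

theorem midCount_bk (k : ℕ) (T : SemistandardYoungTableau μ) (i : ℕ) :
    midCount (bk k T) k i = rowCount T (k + 1) i := by
  have h1 := loCount_le T k i
  have h2 := le_hiCount T k i
  unfold midCount
  rw [loCount_bk, hiCount_bk, rowCount_bk_succ]
  unfold midCount
  omega

/-- Row counts determine the tableau, so involutivity can be checked on them. -/
theorem ext_of_rowCount {T T' : SemistandardYoungTableau μ}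
    (h : ∀ k i, rowCount T k i = rowCount T' k i) : T = T' := by
  refine SemistandardYoungTableau.ext fun i j => ?_
  by_cases hm : (i, j) ∈ μ
  · refine eq_of_forall_gt_iff fun k => ?_
    have h1 := lt_rowCount (T := T) (k := k) (i := i) (j := j)
    have h2 := lt_rowCount (T := T') (k := k) (i := i) (j := j)
    rw [h k i, h2] at h1
    simpa [hm] using h1.symm
  · rw [T.zeros hm, T'.zeros hm]

theorem bk_bk (k : ℕ) (T : SemistandardYoungTableau μ) : bk k (bk k T) = T := by
  refine ext_of_rowCount fun m i => ?_
  by_cases hm : m = k + 1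
  · subst hm
    rw [rowCount_bk_succ, midCount_bk]
  · rw [rowCount_bk_of_le _ _ (by omega), rowCount_bk_of_le _ _ (by omega)]

theorem content_bk (k : ℕ) (T : SemistandardYoungTableau μ) (m : ℕ) :
    content (bk k T) m = content T (Equiv.swap k (k + 1) m) := by
  have hs := sum_loCount_add_hiCount T k
  have hmid : ∑ i ∈ range (μ.colLen 0), midCount T k i +
      ∑ i ∈ range (μ.colLen 0), rowCount T (k + 1) i =
      ∑ i ∈ range (μ.colLen 0), (loCount T k i + hiCount T k i) := by
    rw [← sum_add_distrib]
    refine sum_congr rfl fun i _ => ?_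
    have h1 := le_hiCount T k i
    unfold midCount
    omega
  simp only [sum_add_distrib] at hs hmid
  have c0 := content_add_sum_rowCount T k
  have c1 := content_add_sum_rowCount T (k + 1)
  have d := content_add_sum_rowCount (bk k T) m
  by_cases h1 : m = k
  · subst h1
    rw [Equiv.swap_apply_left]
    simp only [rowCount_bk_succ, rowCount_bk_of_le T _ (Or.inl le_rfl)] at d
    simp only [add_assoc, Nat.reduceAdd] at *
    omega
  by_cases h2 : m = k + 1
  · subst h2
    rw [Equiv.swap_apply_right]
    simp only [add_assoc, Nat.reduceAdd] at *
    simp only [rowCount_bk_succ, rowCount_bk_of_le T _ (Or.inr le_rfl)] at d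
    omega
  · rw [Equiv.swap_apply_of_ne_of_ne h1 h2]
    have c := content_add_sum_rowCount T m
    simp only [rowCount_bk_of_le (k := k) (m := m) T _ (by omega),
      rowCount_bk_of_le (k := k) (m := m + 1) T _ (by omega)] at d
    omega

end BenderKnuth

/-! ### Symmetry of Schur functions. -/

theorem schur_apply (μ : YoungDiagram) (d : ℕ →₀ ℕ) :
    schur μ d = (Nat.card {T : SemistandardYoungTableau μ // ∀ k, content T k = d k} : ℚ) := rfl

theorem schur_swap_succ (μ : YoungDiagram) (d : ℕ →₀ ℕ) (k : ℕ) :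
    schur μ (d.equivMapDomain (Equiv.swap k (k + 1))) = schur μ d := by
  rw [schur_apply, schur_apply, Nat.cast_inj]
  refine Nat.card_congr
    ⟨fun T => ⟨bk k T.1, fun m => ?_⟩, fun T => ⟨bk k T.1, fun m => ?_⟩,
      fun T => Subtype.ext (bk_bk k T.1), fun T => Subtype.ext (bk_bk k T.1)⟩
  · rw [content_bk, T.2, Finsupp.equivMapDomain_apply, Equiv.symm_swap, Equiv.swap_apply_self]
  · rw [content_bk, T.2, Finsupp.equivMapDomain_apply, Equiv.symm_swap]

/-- The permutations of the variables under which a power series is invariant. -/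
def stabilizer {R : Type*} (f : (ℕ →₀ ℕ) → R) : Subgroup (Equiv.Perm ℕ) where
  carrier := {σ | ∀ d : ℕ →₀ ℕ, f (d.equivMapDomain σ) = f d}
  one_mem' d := by
    rw [Equiv.Perm.one_def, Finsupp.equivMapDomain_refl]
  mul_mem' {a b} ha hb d := by
    rw [Equiv.Perm.mul_def, Finsupp.equivMapDomain_trans, ha, hb]
  inv_mem' {a} ha d := by
    rw [← ha, ← Finsupp.equivMapDomain_trans,
      show a⁻¹.trans a = Equiv.refl ℕ from mul_inv_cancel a, Finsupp.equivMapDomain_refl]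

theorem swap_mem_of_swap_succ_mem (H : Subgroup (Equiv.Perm ℕ))
    (h : ∀ k, Equiv.swap k (k + 1) ∈ H) (i j : ℕ) : Equiv.swap i j ∈ H := by
  have key : ∀ m i, Equiv.swap i (i + m) ∈ H := by
    intro m
    induction m with
    | zero => intro i; rw [add_zero, Equiv.swap_self]; exact H.one_mem
    | succ m ih =>
      intro i
      rcases Nat.eq_zero_or_pos m with rfl | hm
      · exact h i
      · have : Equiv.swap i (i + (m + 1)) =
            Equiv.swap (i + m) (i + m + 1) * Equiv.swap i (i + m) *
              Equiv.swap (i + m) (i + m + 1) := by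
          rw [Equiv.swap_mul_swap_mul_swap (by omega) (by omega), add_assoc, Equiv.swap_comm]
        rw [this]
        exact H.mul_mem (H.mul_mem (h _) (ih i)) (h _)
  rcases le_total i j with hij | hij
  · obtain ⟨m, rfl⟩ := Nat.exists_eq_add_of_le hij
    exact key m i
  · obtain ⟨m, rfl⟩ := Nat.exists_eq_add_of_le hij
    rw [Equiv.swap_comm]
    exact key m j

/-- Adjacent transpositions generate exactly the permutations of finite support, hence the
finiteness condition here and below. -/
theorem mem_of_swap_succ_mem (H : Subgroup (Equiv.Perm ℕ))
    (h : ∀ k, Equiv.swap k (k + 1) ∈ H) {σ : Equiv.Perm ℕ} (hσ : {x | σ x ≠ x}.Finite) : σ ∈ H := by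
  have h1 : σ ∈ Subgroup.closure {f : Equiv.Perm ℕ | f.IsSwap} := by
    rw [mem_closure_isSwap']
    exact hσ
  refine (Subgroup.closure_le H).2 ?_ h1
  rintro f ⟨i, j, _, rfl⟩
  exact swap_mem_of_swap_succ_mem H h i j

theorem coeff_sum_schur (c : YoungDiagram →₀ ℕ) (d : ℕ →₀ ℕ) :
    MvPowerSeries.coeff d (c.sum fun μ m => m • schur μ) = c.sum fun μ m => m • schur μ d := by
  unfold Finsupp.sum
  exact map_sum (MvPowerSeries.coeff (R := ℚ) d) _ _

theorem SchurPositive.symmetric {n : ℕ} {f : MvPowerSeries ℕ ℚ} (hf : SchurPositive n f)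
    {σ : Equiv.Perm ℕ} (hσ : {x | σ x ≠ x}.Finite) (d : ℕ →₀ ℕ) :
    f (d.equivMapDomain σ) = f d := by
  obtain ⟨c, -, rfl⟩ := hf
  refine mem_of_swap_succ_mem (stabilizer _) (fun k e => ?_) hσ d
  refine (coeff_sum_schur c _).trans (Eq.trans ?_ (coeff_sum_schur c e).symm)
  simp only [schur_swap_succ]

/-! ### Coefficients of quasisymmetric functions at contents of words. -/

variable {n : ℕ}

/-- The position `i` among the positions `0, …, n - 1`. -/
def fstPos (i : Fin (n - 1)) : Fin n := ⟨i, by have := i.isLt; omega⟩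

/-- The position that follows `i` among the positions `0, …, n - 1`. -/
def sndPos (i : Fin (n - 1)) : Fin n := ⟨i + 1, by have := i.isLt; omega⟩

theorem fstPos_lt_sndPos (i : Fin (n - 1)) : fstPos i < sndPos i := Nat.lt_add_one (i : ℕ)

theorem le_fstPos {i : Fin (n - 1)} {a : Fin n} (h : a < sndPos i) : a ≤ fstPos i :=
  Nat.le_of_lt_succ h

theorem exists_sndPos_eq {a b : Fin n} (h : a < b) : ∃ i : Fin (n - 1), sndPos i = b := by
  have h1 := b.isLt
  have h2 : (a : ℕ) < b := h
  exact ⟨⟨b - 1, by omega⟩, Fin.ext (Nat.sub_add_cancel (by omega))⟩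

theorem mem_Des {π : Equiv.Perm (Fin n)} {i : Fin (n - 1)} :
    i ∈ Des π ↔ π (sndPos i) < π (fstPos i) := by
  simp [Des, fstPos, sndPos]

theorem notMem_Des {π : Equiv.Perm (Fin n)} {i : Fin (n - 1)} :
    i ∉ Des π ↔ π (fstPos i) < π (sndPos i) := by
  rw [mem_Des, not_lt, le_iff_lt_or_eq, or_iff_left]
  exact fun h => (fstPos_lt_sndPos i).ne (π.injective h)

/-- The content of a word: the exponent vector of the product of the variables indexed by its
letters. -/
noncomputable def wordContent (w : Fin n → ℕ) : ℕ →₀ ℕ := ∑ q, Finsupp.single (w q) 1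

/-- The set of strict ascents of a word. -/
def ascents (w : Fin n → ℕ) : Finset (Fin (n - 1)) :=
  univ.filter fun i => w (fstPos i) < w (sndPos i)

theorem mem_ascents {w : Fin n → ℕ} {i : Fin (n - 1)} :
    i ∈ ascents w ↔ w (fstPos i) < w (sndPos i) := by
  simp [ascents]

theorem eq_of_wordContent_eq {w w' : Fin n → ℕ} (hw : Monotone w) (hw' : Monotone w')
    (h : wordContent w = wordContent w') : w = w' := by
  have key : ∀ v : Fin n → ℕ,
      wordContent v = Multiset.toFinsupp ((List.ofFn v : List ℕ) : Multiset ℕ) := by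
    intro v
    rw [← Fin.univ_val_map, ← Multiset.sum_map_singleton (univ.val.map v), Multiset.map_map]
    exact (sum_congr rfl fun q _ => (Multiset.toFinsupp_singleton (v q)).symm).trans
      (map_sum Multiset.toFinsupp _ _).symm
  rw [key, key, Multiset.toFinsupp.injective.eq_iff, Multiset.coe_eq_coe] at h
  exact List.ofFn_injective
    (h.eq_of_pairwise' hw.sortedLE_ofFn.pairwise hw'.sortedLE_ofFn.pairwise)

theorem wordContent_comp_perm (w : Fin n → ℕ) (κ : Equiv.Perm (Fin n)) :
    wordContent (w ∘ κ) = wordContent w :=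
  Equiv.sum_comp κ fun q => Finsupp.single (w q) 1

theorem wordContent_perm_comp (σ : Equiv.Perm ℕ) (w : Fin n → ℕ) :
    wordContent (σ ∘ w) = (wordContent w).equivMapDomain σ := by
  unfold wordContent
  rw [Finsupp.equivMapDomain_eq_mapDomain, Finsupp.mapDomain_finsetSum]
  simp [Finsupp.mapDomain_single]

theorem wordContent_comp_index (β : Composition n) (i : Fin β.length → ℕ) :
    wordContent (i ∘ β.index) = ∑ k, Finsupp.single (i k) (β.blocksFun k) := by
  unfold wordContent
  rw [← Equiv.sum_comp β.blocksFinEquiv, Fintype.sum_sigma]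
  refine sum_congr rfl fun k _ => ?_
  simp [Composition.blocksFinEquiv]

theorem index_mono (β : Composition n) : Monotone β.index := by
  intro a b hab
  by_contra! h
  have h1 := β.lt_sizeUpTo_index_succ b
  have h2 := β.sizeUpTo_index_le a
  have h3 : β.sizeUpTo (β.index b).succ ≤ β.sizeUpTo (β.index a) :=
    β.monotone_sizeUpTo (Nat.succ_le_of_lt h)
  have h4 : (a : ℕ) ≤ b := hab
  omega

/-- A new block starts at position `q + 1` exactly when `q + 1` is a partial sum; `1 + q` is the
form found in `compositionAsSetEquiv`. -/
theorem index_fstPos_lt_iff (β : Composition n) (q : Fin (n - 1)) :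
    β.index (fstPos q) < β.index (sndPos q) ↔
      (⟨1 + q, by have := q.isLt; omega⟩ : Fin (n + 1)) ∈ β.boundaries := by
  have a1 : (fstPos q : ℕ) < β.sizeUpTo (β.index (fstPos q) : ℕ).succ :=
    β.lt_sizeUpTo_index_succ (fstPos q)
  have b2 := β.sizeUpTo_index_le (sndPos q)
  have a2 := β.sizeUpTo_index_le (fstPos q)
  have b1 : (sndPos q : ℕ) < β.sizeUpTo (β.index (sndPos q) : ℕ).succ :=
    β.lt_sizeUpTo_index_succ (sndPos q)
  rw [show ((fstPos q : Fin n) : ℕ) = q from rfl] at a1 a2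
  rw [show ((sndPos q : Fin n) : ℕ) = q + 1 from rfl] at b1 b2
  simp only [Composition.boundaries, mem_map, mem_univ, true_and]
  constructor
  · intro h
    have h3 : β.sizeUpTo (β.index (fstPos q) : ℕ).succ ≤ β.sizeUpTo (β.index (sndPos q)) :=
      β.monotone_sizeUpTo (Nat.succ_le_of_lt h)
    refine ⟨(β.index (sndPos q)).castSucc, Fin.ext ?_⟩
    change β.sizeUpTo (β.index (sndPos q)) = 1 + q
    omega
  · rintro ⟨k, hk⟩
    have hk' : β.sizeUpTo k = 1 + q := congrArg Fin.val hk
    have l1 : (β.index (fstPos q) : ℕ) < k := by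
      by_contra! h
      have := β.monotone_sizeUpTo h
      omega
    have l2 : (k : ℕ) ≤ β.index (sndPos q) := by
      by_contra! h
      have : β.sizeUpTo (β.index (sndPos q) : ℕ).succ ≤ β.sizeUpTo k :=
        β.monotone_sizeUpTo (Nat.succ_le_of_lt h)
      omega
    exact l1.trans_le l2

/-- The set of inner partial sums of a composition. -/
def innerBoundaries (β : Composition n) : Finset (Fin (n - 1)) :=
  compositionAsSetEquiv n (compositionEquiv n β)

theorem co_innerBoundaries (β : Composition n) : co (innerBoundaries β) = β := by
  unfold co innerBoundaries
  rw [Equiv.symm_apply_apply]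
  exact (compositionEquiv n).symm_apply_apply β

theorem innerBoundaries_co (D : Finset (Fin (n - 1))) : innerBoundaries (co D) = D := by
  unfold innerBoundaries
  rw [show co D = (compositionEquiv n).symm ((compositionAsSetEquiv n).symm D) from rfl,
    Equiv.apply_symm_apply, Equiv.apply_symm_apply]

theorem mem_innerBoundaries {β : Composition n} {q : Fin (n - 1)} :
    q ∈ innerBoundaries β ↔ β.index (fstPos q) < β.index (sndPos q) := by
  rw [index_fstPos_lt_iff]
  simp [innerBoundaries, compositionAsSetEquiv, compositionEquiv, Composition.toCompositionAsSet]

theorem refines_co_iff {β : Composition n} {D : Finset (Fin (n - 1))} :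
    Refines β (co D) ↔ D ⊆ innerBoundaries β := by
  constructor
  · intro h q hq
    rw [mem_innerBoundaries, index_fstPos_lt_iff]
    apply h
    rwa [← index_fstPos_lt_iff, ← mem_innerBoundaries, innerBoundaries_co]
  · intro h x hx
    rw [co, CompositionAsSet.toComposition_boundaries] at hx
    simp only [compositionAsSetEquiv, Equiv.coe_fn_symm_mk, Set.toFinset_ofPred, mem_filter,
      mem_univ, true_and] at hx
    rcases hx with rfl | rfl | ⟨q, hq, hx⟩
    · exact β.toCompositionAsSet.zero_mem
    · exact β.toCompositionAsSet.getLast_mem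
    · have := h hq
      rw [mem_innerBoundaries, index_fstPos_lt_iff] at this
      convert this
      omega

theorem innerBoundaries_eq_ascents {β : Composition n} {i : Fin β.length → ℕ}
    (hi : StrictMono i) : innerBoundaries β = ascents (i ∘ β.index) := by
  ext q
  rw [mem_innerBoundaries, mem_ascents]
  exact hi.lt_iff_lt.symm

theorem index_surjective (β : Composition n) : Function.Surjective β.index := fun k =>
  ⟨β.embedding k ⟨0, β.one_le_blocksFun k⟩, β.index_embedding k _⟩

theorem eq_of_index_eq {w : Fin n → ℕ} (hw : Monotone w) {β : Composition n}
    (hβ : innerBoundaries β = ascents w) {a b : Fin n} (hab : a ≤ b)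
    (h : β.index a = β.index b) : w a = w b := by
  obtain ⟨m, hm⟩ := Nat.exists_eq_add_of_le (show (a : ℕ) ≤ b from hab)
  induction m generalizing b with
  | zero => rw [Fin.ext (hm.trans (add_zero _))]
  | succ m ih =>
    obtain ⟨q, rfl⟩ := exists_sndPos_eq (show a < b from show (a : ℕ) < b by omega)
    have hm' : (fstPos q : ℕ) = a + m := Nat.succ_injective hm
    have hle : a ≤ fstPos q := show (a : ℕ) ≤ fstPos q by omega
    have h2 := index_mono β (fstPos_lt_sndPos q).le
    have h3 := (index_mono β hle).antisymm (h2.trans h.ge)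
    rw [ih hle h3 hm']
    refine (hw (fstPos_lt_sndPos q).le).antisymm ?_
    rw [← not_lt, ← mem_ascents, ← hβ, mem_innerBoundaries, ← h3, h]
    exact lt_irrefl _

theorem lt_of_index_lt {w : Fin n → ℕ} (hw : Monotone w) {β : Composition n}
    (hβ : innerBoundaries β = ascents w) {a b : Fin n} (h : β.index a < β.index b) :
    w a < w b := by
  have hab : a < b := (index_mono β).reflect_lt h
  obtain ⟨m, hm⟩ := Nat.exists_eq_add_of_le (show (a : ℕ) ≤ b from hab.le)
  induction m generalizing b with
  | zero => exact absurd (Fin.ext (hm.trans (add_zero _))) hab.ne'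
  | succ m ih =>
    obtain ⟨q, rfl⟩ := exists_sndPos_eq hab
    have hm' : (fstPos q : ℕ) = a + m := Nat.succ_injective hm
    have h2 := index_mono β (fstPos_lt_sndPos q).le
    rcases h2.eq_or_lt with h3 | h3
    · rw [← h3] at h
      exact (ih h ((index_mono β).reflect_lt h) hm').trans_le (hw (fstPos_lt_sndPos q).le)
    · rw [← mem_innerBoundaries, hβ, mem_ascents] at h3
      exact (hw (le_fstPos hab)).trans_lt h3

/-- The blocks of `β` are the maximal constant runs of `w`, so `w` factors through the block index.
-/
theorem exists_strictMono_comp_index {w : Fin n → ℕ} (hw : Monotone w) {β : Composition n}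
    (hβ : innerBoundaries β = ascents w) :
    ∃ i : Fin β.length → ℕ, StrictMono i ∧ i ∘ β.index = w := by
  obtain ⟨r, hr⟩ := (index_surjective β).hasRightInverse
  refine ⟨w ∘ r, fun k l hkl => lt_of_index_lt hw hβ (by rwa [hr, hr]), ?_⟩
  funext a
  have h := hr (β.index a)
  rcases le_total (r (β.index a)) a with hle | hle
  · exact eq_of_index_eq hw hβ hle h
  · exact (eq_of_index_eq hw hβ hle h.symm).symm

/-- A monomial of degree `n` occurs in just one `M_β`, the one given by the run lengths of its
sorted word. -/
theorem monomialQSym_wordContent {w : Fin n → ℕ} (hw : Monotone w) (β : Composition n) :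
    monomialQSym β (wordContent w) = if β = co (ascents w) then 1 else 0 := by
  have key : ∀ i : Fin β.length → ℕ, (StrictMono i ∧
      ∑ k, Finsupp.single (i k) (β.blocksFun k) = wordContent w) ↔
      (StrictMono i ∧ i ∘ β.index = w) := by
    intro i
    refine and_congr_right fun hi => ?_
    rw [← wordContent_comp_index]
    exact ⟨eq_of_wordContent_eq (hi.monotone.comp (index_mono β)) hw, fun h => by rw [h]⟩
  unfold monomialQSym
  simp only [key]
  split_ifs with h
  · rw [← Nat.cast_one, Nat.cast_inj, Nat.card_eq_one_iff_unique]
    constructor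
    · exact ⟨fun a b => Subtype.ext
        ((index_surjective β).injective_comp_right (a.2.2.trans b.2.2.symm))⟩
    · obtain ⟨i, hi⟩ := exists_strictMono_comp_index hw (β := β) (by rw [h, innerBoundaries_co])
      exact ⟨i, hi⟩
  · rw [← Nat.cast_zero, Nat.cast_inj, Nat.card_eq_zero]
    left
    refine ⟨fun i => h ?_⟩
    rw [← i.2.2, ← innerBoundaries_eq_ascents i.2.1, co_innerBoundaries]

theorem fundamentalQSym_wordContent {w : Fin n → ℕ} (hw : Monotone w)
    (D : Finset (Fin (n - 1))) :
    fundamentalQSym (co D) (wordContent w) = if D ⊆ ascents w then 1 else 0 := by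
  change MvPowerSeries.coeff (wordContent w) (fundamentalQSym (co D)) = _
  rw [fundamentalQSym, map_sum]
  refine (sum_congr rfl fun β _ => monomialQSym_wordContent hw β).trans ?_
  rw [sum_ite_eq']
  simp [refines_co_iff, innerBoundaries_co]

theorem Q_wordContent {w : Fin n → ℕ} (hw : Monotone w) (B : Multiset (Equiv.Perm (Fin n))) :
    Q B (wordContent w) = (B.countP fun π => Des π ⊆ ascents w : ℕ) := by
  unfold Q
  refine (map_multiset_sum (MvPowerSeries.coeff (R := ℚ) (wordContent w)) _).trans ?_
  rw [Multiset.map_map]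
  induction B using Multiset.induction_on with
  | empty => simp
  | cons π B ih =>
    rw [Multiset.map_cons, Multiset.sum_cons, ih, Multiset.countP_cons, Function.comp_apply]
    refine (congrArg (· + _) (fundamentalQSym_wordContent hw (Des π))).trans ?_
    push_cast
    ring

theorem IsFine.countP_eq {B : Multiset (Equiv.Perm (Fin n))} (hB : IsFine B)
    {w w' : Fin n → ℕ} (hw : Monotone w) (hw' : Monotone w') {σ : Equiv.Perm ℕ}
    (hσ : {x | σ x ≠ x}.Finite) {κ : Equiv.Perm (Fin n)} (h : w' ∘ κ = σ ∘ w) :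
    (B.countP fun π => Des π ⊆ ascents w) = B.countP fun π => Des π ⊆ ascents w' := by
  have h1 := SchurPositive.symmetric hB hσ (wordContent w)
  rw [← wordContent_perm_comp, ← h, wordContent_comp_perm] at h1
  refine Nat.cast_injective (R := ℚ) ?_
  rw [← Q_wordContent hw, ← Q_wordContent hw']
  exact h1.symm

/-! ### Inverse `J`-classes and standardization. -/

/-- The index of the block of positions that contains `i`, when the positions `0, …, n - 1` are cut
into blocks after the elements of `J`. -/
def blk (J : Finset (Fin (n - 1))) (i : Fin n) : ℕ :=
  (J.filter fun j : Fin (n - 1) => (j : ℕ) < i).card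

theorem blk_mono (J : Finset (Fin (n - 1))) : Monotone (blk J) := fun a _ hab =>
  card_le_card (monotone_filter_right J fun j _ (h : (j : ℕ) < a) => lt_of_lt_of_le h hab)

theorem blk_lt (J : Finset (Fin (n - 1))) (i : Fin n) : blk J i < n + 1 := by
  have h : blk J i ≤ _ := card_le_univ _
  rw [Fintype.card_fin] at h
  omega

theorem blk_lt_blk_iff {J : Finset (Fin (n - 1))} {q : Fin (n - 1)} :
    blk J (fstPos q) < blk J (sndPos q) ↔ q ∈ J := by
  constructor
  · intro h
    by_contra hq
    refine h.not_ge (card_le_card fun j hj => ?_)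
    rw [mem_filter] at hj ⊢
    refine ⟨hj.1, ?_⟩
    have h1 : (j : ℕ) < q + 1 := hj.2
    have h2 : (j : ℕ) ≠ q := fun h => hq (Fin.ext h ▸ hj.1)
    change (j : ℕ) < q
    omega
  · intro hq
    refine card_lt_card ⟨monotone_filter_right J fun j _ (h : (j : ℕ) < q) => ?_, fun h => ?_⟩
    · exact Nat.lt_succ_of_lt h
    · have h1 := h (mem_filter.2 ⟨hq, Nat.lt_add_one (q : ℕ)⟩)
      exact lt_irrefl (q : ℕ) (mem_filter.1 h1).2

theorem blk_eq_blk_iff {J : Finset (Fin (n - 1))} {q : Fin (n - 1)} :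
    blk J (fstPos q) = blk J (sndPos q) ↔ q ∉ J := by
  rw [← blk_lt_blk_iff, not_lt]
  exact ⟨fun h => h.ge, fun h => (blk_mono J (fstPos_lt_sndPos q).le).antisymm h⟩

theorem Des_subset_iff {J : Finset (Fin (n - 1))} {ρ : Equiv.Perm (Fin n)} :
    Des ρ ⊆ J ↔ ∀ a b, a < b → blk J a = blk J b → ρ a < ρ b := by
  constructor
  · intro h a b hab hblk
    obtain ⟨m, hm⟩ := Nat.exists_eq_add_of_le (show (a : ℕ) ≤ b from hab.le)
    induction m generalizing b with
    | zero => exact absurd (Fin.ext (hm.trans (add_zero _))) hab.ne'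
    | succ m ih =>
      obtain ⟨q, rfl⟩ := exists_sndPos_eq hab
      have hle := blk_mono J (le_fstPos hab)
      have hle' := blk_mono J (fstPos_lt_sndPos q).le
      have hstep : ρ (fstPos q) < ρ (sndPos q) :=
        notMem_Des.1 fun hq => blk_eq_blk_iff.1 (hle'.antisymm (hblk.ge.trans hle)) (h hq)
      rcases (le_fstPos hab).eq_or_lt with rfl | hlt
      · exact hstep
      · exact (ih _ hlt (hle.antisymm (hle'.trans hblk.ge)) (Nat.succ_injective hm)).trans hstep
  · intro h q hq
    by_contra hJ
    exact (h _ _ (fstPos_lt_sndPos q) (blk_eq_blk_iff.2 hJ)).not_gt (mem_Des.1 hq)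

theorem mem_invR {J : Finset (Fin (n - 1))} {σ : Equiv.Perm (Fin n)} :
    σ ∈ invR J ↔ Des σ⁻¹ ⊆ J := by
  simp only [invR, mem_image, mem_filter, mem_univ, true_and]
  constructor
  · rintro ⟨π, h, rfl⟩
    rwa [inv_inv]
  · intro h
    exact ⟨σ⁻¹, h, inv_inv σ⟩

theorem mem_invD {J : Finset (Fin (n - 1))} {σ : Equiv.Perm (Fin n)} :
    σ ∈ invD J ↔ Des σ⁻¹ = J := by
  simp only [invD, mem_image, mem_filter, mem_univ, true_and]
  constructor
  · rintro ⟨π, h, rfl⟩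
    rwa [inv_inv]
  · intro h
    exact ⟨σ⁻¹, h, inv_inv σ⟩

/-- Values of `σ` in one block appear from left to right, so comparisons of values can be read off
the block word, with ties broken by position. -/
theorem lt_iff_of_mem_invR {J : Finset (Fin (n - 1))} {σ : Equiv.Perm (Fin n)} (h : σ ∈ invR J)
    (x y : Fin n) :
    σ x < σ y ↔ blk J (σ x) < blk J (σ y) ∨ blk J (σ x) = blk J (σ y) ∧ x < y := by
  rw [mem_invR, Des_subset_iff] at h
  constructor
  · intro hlt
    rcases (blk_mono J hlt.le).lt_or_eq with h1 | h1
    · exact Or.inl h1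
    · exact Or.inr ⟨h1, by simpa using h _ _ hlt h1⟩
  · rintro (h1 | ⟨h1, h2⟩)
    · exact (blk_mono J).reflect_lt h1
    · by_contra hle
      rcases (not_lt.1 hle).lt_or_eq with h3 | h3
      · exact h2.not_gt (by simpa using h _ _ h3 h1.symm)
      · exact h2.ne' (σ.injective h3)

/-- The standardization of the word `blk J ∘ g`: the element of `R_J⁻¹` that induces the same
word. -/
def standardization (J : Finset (Fin (n - 1))) (g : Equiv.Perm (Fin n)) : Equiv.Perm (Fin n) :=
  (Tuple.sort (blk J ∘ g))⁻¹

/-- Sorting a rearrangement of the weakly increasing word `blk J` restores it. -/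
theorem blk_comp_sort (J : Finset (Fin (n - 1))) (g : Equiv.Perm (Fin n)) :
    (blk J ∘ g) ∘ Tuple.sort (blk J ∘ g) = blk J := by
  rw [Tuple.comp_perm_comp_sort_eq_comp_sort,
    Tuple.sort_eq_refl_iff_monotone.2 (blk_mono J)]
  rfl

theorem blk_standardization (J : Finset (Fin (n - 1))) (g : Equiv.Perm (Fin n)) (x : Fin n) :
    blk J (standardization J g x) = blk J (g x) := by
  have h := congrFun (blk_comp_sort J g) (standardization J g x)
  simp only [Function.comp_apply, standardization, Equiv.Perm.coe_inv, Equiv.apply_symm_apply] at h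
  exact h.symm

theorem standardization_mem (J : Finset (Fin (n - 1))) (g : Equiv.Perm (Fin n)) :
    standardization J g ∈ invR J := by
  rw [mem_invR, Des_subset_iff, standardization, inv_inv]
  intro a b hab h
  refine (Tuple.eq_sort_iff.1 rfl).2 a b hab ?_
  rw [← blk_comp_sort J g] at h
  exact h

/-- `Tuple.sort` is the only sorting permutation that keeps equal letters in order, and `σ⁻¹` is
one. -/
theorem eq_standardization {J : Finset (Fin (n - 1))} {σ g : Equiv.Perm (Fin n)}
    (hσ : σ ∈ invR J) (h : ∀ x, blk J (σ x) = blk J (g x)) : σ = standardization J g := by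
  rw [mem_invR, Des_subset_iff] at hσ
  refine inv_injective ?_
  rw [standardization, inv_inv]
  have h' : ∀ x, blk J (g (σ⁻¹ x)) = blk J x := fun x => by
    rw [← h, Equiv.Perm.coe_inv, Equiv.apply_symm_apply]
  refine Tuple.eq_sort_iff.2 ⟨fun a b hab => ?_, fun a b hab he => hσ a b hab ?_⟩
  · simp only [Function.comp_apply, h']
    exact blk_mono J hab
  · simpa only [Function.comp_apply, h'] using he

/-! ### Descents of products. -/

/-- A word in `ℕ` that encodes the pairs `(blk K q, blk J (κ q))`, ordered lexicographically. -/
def pairWord (J K : Finset (Fin (n - 1))) (κ : Equiv.Perm (Fin n)) (q : Fin n) : ℕ :=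
  blk K q * (n + 1) + blk J (κ q)

theorem pairWord_mono {J K : Finset (Fin (n - 1))} {κ : Equiv.Perm (Fin n)} (h : Des κ ⊆ K) :
    Monotone (pairWord J K κ) := by
  intro a b hab
  unfold pairWord
  rcases hab.eq_or_lt with rfl | hlt
  · exact le_rfl
  rcases (blk_mono K hab).eq_or_lt with h1 | h1
  · rw [h1]
    exact Nat.add_le_add_left (blk_mono J (Des_subset_iff.1 h a b hlt h1).le) _
  · have h2 := Nat.mul_le_mul_right (n + 1) (Nat.succ_le_of_lt h1)
    have h3 := blk_lt J (κ a)
    rw [Nat.succ_mul] at h2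
    omega

theorem mem_ascents_pairWord_of_mem {J K : Finset (Fin (n - 1))} (κ : Equiv.Perm (Fin n))
    {q : Fin (n - 1)} (hq : q ∈ K) : q ∈ ascents (pairWord J K κ) := by
  rw [mem_ascents]
  unfold pairWord
  have h2 := Nat.mul_le_mul_right (n + 1) (Nat.succ_le_of_lt (blk_lt_blk_iff.2 hq))
  have h3 := blk_lt J (κ (fstPos q))
  rw [Nat.succ_mul] at h2
  omega

theorem mem_ascents_pairWord_of_notMem {J K : Finset (Fin (n - 1))} (κ : Equiv.Perm (Fin n))
    {q : Fin (n - 1)} (hq : q ∉ K) :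
    q ∈ ascents (pairWord J K κ) ↔ blk J (κ (fstPos q)) < blk J (κ (sndPos q)) := by
  rw [mem_ascents]
  unfold pairWord
  rw [blk_eq_blk_iff.2 hq]
  exact Nat.add_lt_add_iff_left

/-- Only positions outside `K` matter. There `σπ` ascends iff the common block word of `σπ` and `κ`
rises strictly, or is level and `π` ascends. Weak rise is an ascent of `κ`; strict rise is an ascent
of the pair word, needed where `π` descends. -/
theorem Des_mul_subset_iff {J K : Finset (Fin (n - 1))} {σ κ π : Equiv.Perm (Fin n)}
    (hσ : σ ∈ invR J) (hκ : κ ∈ invR J) (h : ∀ x, blk J (κ x) = blk J (σ (π x))) :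
    Des (σ * π) ⊆ K ↔ Des κ ⊆ K ∧ Des π ⊆ ascents (pairWord J K κ) := by
  have key : ∀ q, (q ∈ Des (σ * π) → q ∈ K) ↔
      (q ∈ Des κ → q ∈ K) ∧ (q ∈ Des π → q ∈ ascents (pairWord J K κ)) := by
    intro q
    by_cases hq : q ∈ K
    · simp [hq, mem_ascents_pairWord_of_mem κ hq]
    · have h1 := fstPos_lt_sndPos q
      rw [mem_ascents_pairWord_of_notMem κ hq]
      simp only [hq, imp_false]
      rw [notMem_Des, notMem_Des, Equiv.Perm.mul_apply, Equiv.Perm.mul_apply,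
        lt_iff_of_mem_invR hσ, lt_iff_of_mem_invR hκ, ← h, ← h, ← notMem_Des (π := π)]
      by_cases h2 : q ∈ Des π <;> simp only [h1, h2] <;> grind
  exact (forall_congr' key).trans forall_and

theorem card_filter_Des_mul_left (J K : Finset (Fin (n - 1))) (π : Equiv.Perm (Fin n)) :
    ((invR J).filter fun σ => Des (σ * π) ⊆ K).card =
      (((invR J).filter fun κ => Des κ ⊆ K).filter fun κ =>
        Des π ⊆ ascents (pairWord J K κ)).card := by
  refine card_nbij' (fun σ => standardization J (σ * π)) (fun κ => standardization J (κ * π⁻¹))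
    ?_ ?_ ?_ ?_
  · intro σ hσ
    simp only [coe_filter, Set.mem_ofPred_eq, mem_filter] at hσ ⊢
    rw [and_assoc, ← Des_mul_subset_iff hσ.1 (standardization_mem _ _)
      (blk_standardization J (σ * π))]
    exact ⟨standardization_mem _ _, hσ.2⟩
  · intro κ hκ
    simp only [coe_filter, Set.mem_ofPred_eq, mem_filter, and_assoc] at hκ ⊢
    refine ⟨standardization_mem _ _, (Des_mul_subset_iff (standardization_mem _ _) hκ.1 ?_).2 hκ.2⟩
    intro x
    rw [blk_standardization, Equiv.Perm.mul_apply, Equiv.Perm.coe_inv, Equiv.symm_apply_apply]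
  · intro σ hσ
    simp only [coe_filter, Set.mem_ofPred_eq] at hσ
    refine (eq_standardization hσ.1 fun x => ?_).symm
    rw [Equiv.Perm.mul_apply, blk_standardization, Equiv.Perm.mul_apply,
      Equiv.Perm.coe_inv, Equiv.apply_symm_apply]
  · intro κ hκ
    simp only [coe_filter, Set.mem_ofPred_eq, mem_filter, and_assoc] at hκ
    refine (eq_standardization hκ.1 fun x => ?_).symm
    rw [Equiv.Perm.mul_apply, blk_standardization, Equiv.Perm.mul_apply,
      Equiv.Perm.coe_inv, Equiv.symm_apply_apply]

/-- With `τ = (πσ)⁻¹` one has `τπ = σ⁻¹`, so the conditions imposed by `J` and `K` trade places. -/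
theorem card_filter_Des_mul_right (J K : Finset (Fin (n - 1))) (π : Equiv.Perm (Fin n)) :
    ((invR J).filter fun σ => Des (π * σ) ⊆ K).card =
      ((invR K).filter fun σ => Des (σ * π) ⊆ J).card := by
  refine card_nbij' (fun σ => (π * σ)⁻¹) (fun σ => (σ * π)⁻¹) ?_ ?_ ?_ ?_
  · intro σ hσ
    simp only [coe_filter, Set.mem_ofPred_eq, mem_invR] at hσ ⊢
    simpa [and_comm] using hσ
  · intro σ hσ
    simp only [coe_filter, Set.mem_ofPred_eq, mem_invR] at hσ ⊢
    simpa [and_comm] using hσ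
  · intro σ _
    simp
  · intro σ _
    simp

theorem countP_mulMultiset_left (p : Equiv.Perm (Fin n) → Prop) [DecidablePred p]
    (A : Finset (Equiv.Perm (Fin n))) (B : Multiset (Equiv.Perm (Fin n))) :
    (mulMultiset A.val B).countP p = (B.map fun π => (A.filter fun σ => p (σ * π)).card).sum := by
  induction B using Multiset.induction_on with
  | empty => simp [mulMultiset]
  | cons π B ih =>
    rw [Multiset.map_cons, Multiset.sum_cons, ← ih]
    unfold mulMultiset
    rw [Multiset.product_cons, Multiset.map_add, Multiset.countP_add, Multiset.map_map,
      Multiset.countP_map]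
    rfl

theorem countP_mulMultiset_right (p : Equiv.Perm (Fin n) → Prop) [DecidablePred p]
    (A : Finset (Equiv.Perm (Fin n))) (B : Multiset (Equiv.Perm (Fin n))) :
    (mulMultiset B A.val).countP p = (B.map fun π => (A.filter fun σ => p (π * σ)).card).sum := by
  induction B using Multiset.induction_on with
  | empty => simp [mulMultiset]
  | cons π B ih =>
    rw [Multiset.map_cons, Multiset.sum_cons, ← ih]
    unfold mulMultiset
    rw [Multiset.cons_product, Multiset.map_add, Multiset.countP_add, Multiset.map_map,
      Multiset.countP_map]
    rfl

theorem sum_card_filter_Des_mul (J K : Finset (Fin (n - 1)))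
    (B : Multiset (Equiv.Perm (Fin n))) :
    (B.map fun π => ((invR J).filter fun σ => Des (σ * π) ⊆ K).card).sum =
      ∑ κ ∈ (invR J).filter fun κ => Des κ ⊆ K,
        B.countP fun π => Des π ⊆ ascents (pairWord J K κ) := by
  induction B using Multiset.induction_on with
  | empty => simp
  | cons π B ih =>
    rw [Multiset.map_cons, Multiset.sum_cons, ih, card_filter_Des_mul_left, card_filter,
      ← sum_add_distrib]
    refine sum_congr rfl fun κ _ => ?_
    rw [Multiset.countP_cons, add_comm]

/-! ### Exchanging `J` and `K` by symmetry. -/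

/-- The involution of `ℕ` that sends `a * N + b` to `b * N + a` for `a, b < N`. -/
def digitSwap (N x : ℕ) : ℕ := if x < N * N then x % N * N + x / N else x

theorem digitSwap_apply {N a b : ℕ} (ha : a < N) (hb : b < N) :
    digitSwap N (a * N + b) = b * N + a := by
  have h1 : a * N + b < N * N := by
    have := Nat.mul_le_mul_right N (Nat.succ_le_of_lt ha)
    rw [Nat.succ_mul] at this
    omega
  rw [digitSwap, if_pos h1, Nat.add_comm (a * N) b, Nat.add_mul_mod_self_right,
    Nat.mod_eq_of_lt hb, Nat.add_mul_div_right _ _ (by omega), Nat.div_eq_of_lt hb, zero_add]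

theorem digitSwap_involutive (N : ℕ) : Function.Involutive (digitSwap N) := by
  intro x
  by_cases h : x < N * N
  · have hN : 0 < N := Nat.pos_of_ne_zero (by rintro rfl; simp at h)
    have h1 : x / N < N := Nat.div_lt_of_lt_mul h
    have h2 : x % N < N := Nat.mod_lt x hN
    conv_rhs => rw [← Nat.div_add_mod' x N]
    rw [← digitSwap_apply h2 h1, ← digitSwap_apply h1 h2, Nat.div_add_mod']
  · have h1 : digitSwap N x = x := if_neg h
    rw [h1, h1]

theorem finite_digitSwap_ne (N : ℕ) :
    {x | (digitSwap_involutive N).toPerm (digitSwap N) x ≠ x}.Finite := by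
  refine (Set.finite_lt_nat (N * N)).subset fun x hx => ?_
  by_contra h
  exact hx (if_neg h)

theorem IsFine.sum_countP_eq {B : Multiset (Equiv.Perm (Fin n))} (hB : IsFine B)
    (J K : Finset (Fin (n - 1))) :
    (∑ κ ∈ (invR J).filter fun κ => Des κ ⊆ K,
        B.countP fun π => Des π ⊆ ascents (pairWord J K κ)) =
      ∑ κ ∈ (invR K).filter fun κ => Des κ ⊆ J,
        B.countP fun π => Des π ⊆ ascents (pairWord K J κ) := by
  refine sum_nbij' (fun κ => κ⁻¹) (fun κ => κ⁻¹) ?_ ?_ ?_ ?_ ?_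
  · intro κ hκ
    simpa [mem_invR, and_comm] using hκ
  · intro κ hκ
    simpa [mem_invR, and_comm] using hκ
  · simp
  · simp
  · intro κ hκ
    rw [mem_filter, mem_invR] at hκ
    -- Reading the word of `κ⁻¹` at position `κ q` gives the pair at `q` with its entries exchanged;
    -- block indices are below the base `n + 1`, so they are digits.
    refine hB.countP_eq (pairWord_mono hκ.2) (pairWord_mono hκ.1) (finite_digitSwap_ne (n + 1))
      (κ := κ) (funext fun q => ?_)
    simp only [Function.comp_apply, pairWord, Equiv.Perm.coe_inv, Equiv.symm_apply_apply,
      Function.Involutive.coe_toPerm]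
    exact (digitSwap_apply (blk_lt K q) (blk_lt J (κ q))).symm

theorem IsFine.countP_mul_invR {B : Multiset (Equiv.Perm (Fin n))} (hB : IsFine B)
    (J K : Finset (Fin (n - 1))) :
    (mulMultiset B (invR J).val).countP (Des · ⊆ K) =
      (mulMultiset (invR J).val B).countP (Des · ⊆ K) := by
  rw [countP_mulMultiset_left, countP_mulMultiset_right, sum_card_filter_Des_mul,
    hB.sum_countP_eq, ← sum_card_filter_Des_mul]
  simp only [card_filter_Des_mul_right]

/-! ### Inclusion–exclusion over descent sets. -/

theorem eq_of_sum_powerset_eq {α M : Type*} [DecidableEq α] [AddCancelCommMonoid M]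
    {f g : Finset α → M} (h : ∀ s : Finset α, ∑ t ∈ s.powerset, f t = ∑ t ∈ s.powerset, g t) :
    f = g := by
  funext s
  induction s using Finset.strongInduction with
  | _ s ih =>
    have h1 := h s
    rw [← sum_erase_add _ _ (mem_powerset_self s), ← sum_erase_add _ g (mem_powerset_self s),
      sum_congr rfl fun t ht => ih t ?_] at h1
    · exact add_left_cancel h1
    · rw [mem_erase, mem_powerset] at ht
      exact ht.2.ssubset_of_ne ht.1

theorem sum_powerset_count_Des (A : Multiset (Equiv.Perm (Fin n))) (K : Finset (Fin (n - 1))) :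
    ∑ L ∈ K.powerset, (A.map Des).count L = A.countP (Des · ⊆ K) := by
  induction A using Multiset.induction_on with
  | empty => simp
  | cons π A ih =>
    simp only [Multiset.map_cons, Multiset.count_cons, sum_add_distrib, ih, Multiset.countP_cons]
    simp

theorem desEquiv_of_countP {A B : Multiset (Equiv.Perm (Fin n))}
    (h : ∀ K, A.countP (Des · ⊆ K) = B.countP (Des · ⊆ K)) : DesEquiv A B := by
  refine Multiset.ext.2 (congrFun (eq_of_sum_powerset_eq fun K => ?_))
  rw [sum_powerset_count_Des, sum_powerset_count_Des, h]

/-- `R_J⁻¹` is the disjoint union of the `D_L⁻¹` with `L ⊆ J`. -/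
theorem sum_powerset_card_invD (p : Equiv.Perm (Fin n) → Prop) [DecidablePred p]
    (J : Finset (Fin (n - 1))) :
    ∑ L ∈ J.powerset, ((invD L).filter p).card = ((invR J).filter p).card := by
  rw [card_eq_sum_card_fiberwise (f := fun σ => Des σ⁻¹) (t := J.powerset)]
  · refine sum_congr rfl fun L hL => congrArg card ?_
    ext σ
    rw [mem_powerset] at hL
    simp only [mem_filter, mem_invD, mem_invR]
    constructor
    · rintro ⟨rfl, h⟩
      exact ⟨⟨hL, h⟩, rfl⟩
    · rintro ⟨⟨-, h⟩, rfl⟩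
      exact ⟨rfl, h⟩
  · intro σ hσ
    rw [mem_coe, mem_filter, mem_invR] at hσ
    exact mem_coe.2 (mem_powerset.2 hσ.1)

theorem IsFine.countP_mul_invD {B : Multiset (Equiv.Perm (Fin n))} (hB : IsFine B)
    (J K : Finset (Fin (n - 1))) :
    (mulMultiset B (invD J).val).countP (Des · ⊆ K) =
      (mulMultiset (invD J).val B).countP (Des · ⊆ K) := by
  revert J
  -- Inversion in `J` with `K` fixed: both counts are additive in the inverse class.
  refine congrFun (eq_of_sum_powerset_eq fun J => ?_)
  have h := hB.countP_mul_invR J K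
  simp only [countP_mulMultiset_left, countP_mulMultiset_right] at h ⊢
  rw [← Multiset.sum_map_sum, ← Multiset.sum_map_sum]
  simpa only [sum_powerset_card_invD] using h

end DCommutative

theorem mainTheorem2 {n : ℕ} (B : Multiset (Equiv.Perm (Fin n))) (hB : DCommutative.IsFine B) :
    DCommutative.IsDCommutative B ∧
      ∀ J : Finset (Fin (n - 1)),
        DCommutative.DesEquiv
          (DCommutative.mulMultiset B (DCommutative.invD J).val)
          (DCommutative.mulMultiset (DCommutative.invD J).val B) :=
  ⟨fun J => DCommutative.desEquiv_of_countP (hB.countP_mul_invR J),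
    fun J => DCommutative.desEquiv_of_countP (hB.countP_mul_invD J)⟩
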